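/- Let $\mathbb{T}=\mathbb{R}/\mathbb{Z}$, let $\alpha$ be an irrational number, and let $\mathfrak{f}:\mathbb{T}\to\mathbb{R}$ be continuous, of bounded variation, with $\int_{\mathbb{T}}\mathfrak{f}(z)\,dz=0$. Put $\mathfrak{p}=e^{\mathfrak{f}}/(1+e^{\mathfrak{f}})$ and $\mathfrak{q}=1-\mathfrak{p}$. For $x\in\mathbb{T}$ let $(\xi_n)_{n\ge 0}$ be, under $\mathbb{P}_x$, the nearest-neighbour Markov chain on $\mathbb{Z}$ with $\xi_0=0$ and $$\mathbb{P}_x(\xi_{n+1}=k+1\mid \xi_n=k)=\mathfrak{p}(x+k\alpha),\qquad \mathbb{P}_x(\xi_{n+1}=k-1\mid \xi_n=k)=\mathfrak{q}(x+k\alpha)\qquad(k\in\mathbb{Z},\ n\ge 0),$$ and for $a\in\mathbb{Z}$ let $$\mu_{x,a}=\sum_{n=1}^{\infty}\mathbb{P}_x(\xi_1\neq 0,\ \ldots,\ \xi_{n-1}\neq 0,\ \xi_n=a),$$ the expected number of visits of $(\xi_n)$ to $a$ at times from $1$ up to and including the first return to $0$. Then $0<\mu_{x,a}<\infty$ for all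 $x\in\mathbb{T}$ and $a\in\mathbb{Z}$, and for every $\varepsilon>0$ and every integer $q\ge 2$ there exists $n_0$ such that for every $n\ge n_0$, every $x\in\mathbb{T}$ and all integers $a,b\in[-q,q]$ both with the same parity as $n$, one has $\mathbb{P}_x(\xi_n=b)>0$ and $$\left|\frac{\mathbb{P}_x(\xi_n=a)}{\mathbb{P}_x(\xi_n=b)}-\frac{\mu_{x,a}}{\mu_{x,b}}\right|<\varepsilon .$$ -/

import Mathlib

open MeasureTheory ProbabilityTheory

open scoped ENNReal

noncomputable section

namespace QuasiPeriodicWalk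

/-- Bounded variation of a real function on the circle `ℝ / ℤ`: its lift to the fundamental
interval `[0, 1]` (both endpoints included) has finite total variation. -/
def CircleBV (f : UnitAddCircle → ℝ) : Prop :=
  BoundedVariationOn (fun t : ℝ => f (t : UnitAddCircle)) (Set.Icc 0 1)

/-- The probability of a step to the right, `𝔭 = exp 𝔣 / (1 + exp 𝔣)`. -/
def rightProb (f : UnitAddCircle → ℝ) (x : UnitAddCircle) : ℝ :=
  Real.exp (f x) / (1 + Real.exp (f x))

/-- The probability of a step to the left, `𝔮 = 1 - 𝔭`. -/
def leftProb (f : UnitAddCircle → ℝ) (x : UnitAddCircle) : ℝ :=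
  1 - rightProb f x

theorem rightProb_nonneg (f : UnitAddCircle → ℝ) (x : UnitAddCircle) : 0 ≤ rightProb f x := by
  unfold rightProb
  positivity

theorem leftProb_nonneg (f : UnitAddCircle → ℝ) (x : UnitAddCircle) : 0 ≤ leftProb f x := by
  have h : rightProb f x ≤ 1 := by
    unfold rightProb
    rw [div_le_one (by positivity)]
    linarith
  unfold leftProb
  linarith

/-- The point `x + k α` of the circle, which determines the environment at the site `k`. -/
def site (α : ℝ) (x : UnitAddCircle) (k : ℤ) : UnitAddCircle :=
  x + ((k * α : ℝ) : UnitAddCircle)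

/-- The law of the next position of the walk, in the environment `(𝔭, α, x)`, from the site `k`. -/
def stepLaw (f : UnitAddCircle → ℝ) (α : ℝ) (x : UnitAddCircle) (k : ℤ) : Measure ℤ :=
  ENNReal.ofReal (rightProb f (site α x k)) • Measure.dirac (k + 1) +
    ENNReal.ofReal (leftProb f (site α x k)) • Measure.dirac (k - 1)

instance (f : UnitAddCircle → ℝ) (α : ℝ) (x : UnitAddCircle) (k : ℤ) :
    IsProbabilityMeasure (stepLaw f α x k) := by
  refine ⟨?_⟩
  have h : rightProb f (site α x k) + leftProb f (site α x k) = 1 := by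
    unfold leftProb
    ring
  simp [stepLaw, ← ENNReal.ofReal_add (rightProb_nonneg f _) (leftProb_nonneg f _), h]

/-- The transition kernel of the walk on `ℤ` in the environment `(𝔭, α, x)`. -/
def stepKernel (f : UnitAddCircle → ℝ) (α : ℝ) (x : UnitAddCircle) : Kernel ℤ ℤ :=
  Kernel.ofFunOfCountable (stepLaw f α x)

instance (f : UnitAddCircle → ℝ) (α : ℝ) (x : UnitAddCircle) :
    IsMarkovKernel (stepKernel f α x) :=
  ⟨fun k => inferInstanceAs (IsProbabilityMeasure (stepLaw f α x k))⟩

/-- The law of the position at time `n + 1` given the whole history up to time `n`: it depends on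
the history only through the position at time `n`. -/
def historyKernel (f : UnitAddCircle → ℝ) (α : ℝ) (x : UnitAddCircle) (n : ℕ) :
    Kernel (Finset.Iic n → ℤ) ℤ :=
  (stepKernel f α x).comap (fun h => h ⟨n, Finset.mem_Iic.2 le_rfl⟩) (by fun_prop)

instance (f : UnitAddCircle → ℝ) (α : ℝ) (x : UnitAddCircle) (n : ℕ) :
    IsMarkovKernel (historyKernel f α x n) := by
  unfold historyKernel
  infer_instance

/-- The law `P_x` of the walk `(ξ_n)` with `ξ_0 = 0` in the environment `(𝔭, α, x)`, on the space
of all sequences `ω : ℕ → ℤ`; the walk is the coordinate process `ξ_n ω = ω n`. It is built by the Ionescu-Tulcea theorem from the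
history up to time `0`, which is the constant `0`. -/
def walkLaw (f : UnitAddCircle → ℝ) (α : ℝ) (x : UnitAddCircle) : Measure (ℕ → ℤ) :=
  Kernel.traj (X := fun _ => ℤ) (historyKernel f α x) 0 (fun _ => 0)

/-- `P_x (ξ_n = a)`. -/
def posProb (f : UnitAddCircle → ℝ) (α : ℝ) (x : UnitAddCircle) (n : ℕ) (a : ℤ) : ℝ :=
  (walkLaw f α x).real {ω | ω n = a}

/-- `μ_{x,a} = ∑_{n ≥ 1} P_x (ξ_1 ≠ 0, …, ξ_{n-1} ≠ 0, ξ_n = a)`; the summation index below is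
`n - 1`. -/
def excursionDensity (f : UnitAddCircle → ℝ) (α : ℝ) (x : UnitAddCircle) (a : ℤ) : ℝ≥0∞ :=
  ∑' m : ℕ, walkLaw f α x {ω | (∀ i : ℕ, 1 ≤ i → i ≤ m → ω i ≠ 0) ∧ ω (m + 1) = a}

end QuasiPeriodicWalk

end

namespace QuasiPeriodicWalk

open Filter Topology

/-! The walk is reversible for an explicit measure m, the `weight`. Detailed balance turns P(ξ_n =
a) into (m_a/m_0) times the probability `trans` of going from a to 0 in n steps
(`weight_zero_mul_posProb`). Reversing excursions in the same way gives μ_a = m_a/m_0 when the walk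
is recurrent (`excursionDensity_eq`). It remains to see that the n-step probability of reaching 0
hardly depends on the starting point in [-q, q].

At even times the lower bound conditions on the first visit to the target and uses that even return
probabilities decrease; the upper bound comes from positivity of a squared norm
(`trans_two_mul_le_add`) combined with the lower bound with the roles exchanged. Both errors are
controlled by the probability `surv` of not yet having hit (`trans_two_mul_bounds`).

Recurrence holds in every environment: by Denjoy–Koksma (`exists_abs_birkhoff_le`) the potential
stays bounded above along sequences going to both infinities, and a maximum principle applies
(`tendsto_surv_zero`). Since `surv` is continuous in x and decreasing in n, Dini's theorem on the
circle makes everything uniform in x. -/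

/-! ### Transition and survival probabilities of a nearest-neighbour walk. -/

/-- One step of the backward evolution of the nearest-neighbour walk on `ℤ` with probabilities `p k`
to the right and `1 - p k` to the left. -/
def avg (p u : ℤ → ℝ) (k : ℤ) : ℝ := p k * u (k + 1) + (1 - p k) * u (k - 1)

/-- The probability `trans p b n k` to be at `b` at time `n`, for the walk started at `k`. -/
def trans (p : ℤ → ℝ) (b : ℤ) (n : ℕ) : ℤ → ℝ := (avg p)^[n] (Pi.single b 1)

/-- The probability that the walk started at `k` does not visit `b` up to time `n`. -/
def surv (p : ℤ → ℝ) (b : ℤ) : ℕ → ℤ → ℝ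
  | 0 => fun k => if k = b then 0 else 1
  | n + 1 => fun k => if k = b then 0 else avg p (surv p b n) k

/-- The weights `m` are reversible for the walk with probabilities `p` to the right. -/
structure Reversible (p m : ℤ → ℝ) : Prop where
  pos : ∀ k, 0 < p k
  lt_one : ∀ k, p k < 1
  weight_pos : ∀ k, 0 < m k
  balance : ∀ k, m k * p k = m (k + 1) * (1 - p (k + 1))

lemma trans_zero (p : ℤ → ℝ) (b k : ℤ) : trans p b 0 k = if k = b then 1 else 0 := by
  simp [trans, Pi.single_apply]

lemma trans_succ (p : ℤ → ℝ) (b : ℤ) (n : ℕ) : trans p b (n + 1) = avg p (trans p b n) := by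
  simp only [trans, Function.iterate_succ_apply']

@[simp] lemma surv_self (p : ℤ → ℝ) (b : ℤ) (n : ℕ) : surv p b n b = 0 := by
  cases n <;> simp [surv]

lemma surv_succ_of_ne (p : ℤ → ℝ) {b k : ℤ} (h : k ≠ b) (n : ℕ) :
    surv p b (n + 1) k = avg p (surv p b n) k := by
  simp [surv, h]

lemma avg_mono {p u v : ℤ → ℝ} {k : ℤ} (h0 : 0 ≤ p k) (h1 : p k ≤ 1)
    (hr : u (k + 1) ≤ v (k + 1)) (hl : u (k - 1) ≤ v (k - 1)) : avg p u k ≤ avg p v k := by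
  unfold avg
  have : 0 ≤ 1 - p k := by linarith
  gcongr

lemma avg_const (p : ℤ → ℝ) (c : ℝ) (k : ℤ) : avg p (fun _ => c) k = c := by
  unfold avg
  ring

section Bounds

variable {p : ℤ → ℝ} (h0 : ∀ k, 0 < p k) (h1 : ∀ k, p k < 1)
include h0 h1

lemma surv_nonneg (b : ℤ) (n : ℕ) (k : ℤ) : 0 ≤ surv p b n k := by
  induction n generalizing k with
  | zero => simp only [surv]; split_ifs <;> norm_num
  | succ n ih =>
    by_cases h : k = b
    · simp [h]
    · rw [surv_succ_of_ne p h, ← avg_const p 0 k]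
      exact avg_mono (h0 k).le (h1 k).le (ih _) (ih _)

lemma surv_le_one (b : ℤ) (n : ℕ) (k : ℤ) : surv p b n k ≤ 1 := by
  induction n generalizing k with
  | zero => simp only [surv]; split_ifs <;> norm_num
  | succ n ih =>
    by_cases h : k = b
    · simp [h]
    · rw [surv_succ_of_ne p h, ← avg_const p 1 k]
      exact avg_mono (h0 k).le (h1 k).le (ih _) (ih _)

lemma surv_succ_le (b : ℤ) (n : ℕ) (k : ℤ) : surv p b (n + 1) k ≤ surv p b n k := by
  by_cases h : k = b
  · simp [h]
  induction n generalizing k with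
  | zero =>
    have := surv_le_one h0 h1 b 1 k
    simpa [surv, h] using this
  | succ n ih =>
    have key : ∀ j, surv p b (n + 1) j ≤ surv p b n j := fun j => by
      by_cases hj : j = b
      · simp [hj]
      · exact ih j hj
    rw [surv_succ_of_ne p h, surv_succ_of_ne p h]
    exact avg_mono (h0 k).le (h1 k).le (key _) (key _)

lemma surv_antitone (b k : ℤ) : Antitone fun n => surv p b n k :=
  antitone_nat_of_succ_le fun n => surv_succ_le h0 h1 b n k

lemma trans_nonneg (b : ℤ) (n : ℕ) (k : ℤ) : 0 ≤ trans p b n k := by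
  induction n generalizing k with
  | zero => rw [trans_zero]; split_ifs <;> norm_num
  | succ n ih =>
    rw [trans_succ, ← avg_const p 0 k]
    exact avg_mono (h0 k).le (h1 k).le (ih _) (ih _)

/-- The walk may oscillate i times between b and b + 1. -/
lemma trans_two_mul_pos (b : ℤ) (i : ℕ) : 0 < trans p b (2 * i) b := by
  induction i with
  | zero => simp [trans_zero]
  | succ i ih =>
    rw [show 2 * (i + 1) = 2 * i + 1 + 1 by ring, trans_succ]
    have hl : 0 < trans p b (2 * i + 1) (b + 1) := by
      rw [trans_succ, avg, add_sub_cancel_right]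
      have := trans_nonneg h0 h1 b (2 * i) (b + 1 + 1)
      have := h0 (b + 1)
      have : 0 < 1 - p (b + 1) := by linarith [h1 (b + 1)]
      positivity
    have := trans_nonneg h0 h1 b (2 * i + 1) (b - 1)
    have := h0 b
    have : 0 < 1 - p b := by linarith [h1 b]
    rw [avg]
    positivity

/-- Comparison with the return probability at an earlier time, by conditioning on the first visit
of `b`. -/
lemma one_sub_surv_mul_le_trans {b : ℤ} {U : ℝ} {N : ℕ}
    (h : ∀ n ≤ N, Even n → U ≤ trans p b n b) (n : ℕ) (hn : n ≤ N) (k : ℤ)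
    (hk : k ≡ b + n [ZMOD 2]) : (1 - surv p b n k) * U ≤ trans p b n k := by
  induction n generalizing k with
  | zero =>
    by_cases hkb : k = b
    · subst hkb; simpa using h 0 hn (by simp)
    · simp [surv, trans_zero, hkb]
  | succ n ih =>
    by_cases hkb : k = b
    · subst hkb
      simpa using h _ hn (by
        rw [Int.ModEq] at hk
        rw [Nat.even_iff]
        push_cast at hk
        omega)
    · have hp : k + 1 ≡ b + n [ZMOD 2] := by
        rw [Int.ModEq] at hk ⊢; push_cast at hk; omega
      have hm : k - 1 ≡ b + n [ZMOD 2] := by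
        rw [Int.ModEq] at hk ⊢; push_cast at hk; omega
      rw [surv_succ_of_ne p hkb, trans_succ]
      refine le_trans (le_of_eq ?_) (avg_mono (u := fun j => (1 - surv p b n j) * U)
        (h0 k).le (h1 k).le (ih (by omega) _ hp) (ih (by omega) _ hm))
      simp only [avg]
      ring

end Bounds

/-! ### Reversibility and comparison of starting points. -/

lemma finite_support_avg (p : ℤ → ℝ) {u : ℤ → ℝ} (hu : u.support.Finite) :
    (avg p u).support.Finite := by
  refine ((hu.image (· - 1)).union (hu.image (· + 1))).subset fun k hk => ?_
  by_contra hcon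
  simp only [Set.mem_union, Set.mem_image, Function.mem_support, not_or, not_exists, not_and] at hcon
  have h1 : u (k + 1) = 0 := by
    by_contra h; exact hcon.1 _ h (by ring)
  have h2 : u (k - 1) = 0 := by
    by_contra h; exact hcon.2 _ h (by ring)
  exact hk (by simp [avg, h1, h2])

lemma finite_support_trans (p : ℤ → ℝ) (b : ℤ) (n : ℕ) : (trans p b n).support.Finite := by
  induction n with
  | zero =>
    refine (Set.finite_singleton b).subset fun k hk => ?_
    by_contra h
    exact hk (by rw [trans_zero, if_neg (by simpa using h)])
  | succ n ih => rw [trans_succ]; exact finite_support_avg p ih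

/-- The weighted scalar product of two functions on `ℤ`. -/
noncomputable def form (m u v : ℤ → ℝ) : ℝ := ∑' k, m k * u k * v k

lemma summable_of_support_finite {g u : ℤ → ℝ} (hu : u.support.Finite)
    (h : ∀ k, u k = 0 → g k = 0) : Summable g :=
  summable_of_hasFiniteSupport (hu.subset fun k hk huk => hk (h k huk))

lemma tsum_add_one (g : ℤ → ℝ) : ∑' k, g (k + 1) = ∑' k, g k :=
  (Equiv.addRight (1 : ℤ)).tsum_eq g

lemma finite_support_shift {u : ℤ → ℝ} (hu : u.support.Finite) (c : ℤ) :
    (fun k => u (k + c)).support.Finite :=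
  (hu.image (· - c)).subset fun k hk => ⟨k + c, hk, by simp⟩

section Form

variable {p m : ℤ → ℝ} (hr : Reversible p m)
include hr

/-- Self-adjointness: after a shift of the index, detailed balance exchanges the right-step and
left-step sums. -/
lemma form_avg_left {u : ℤ → ℝ} (hu : u.support.Finite) (v : ℤ → ℝ) :
    form m (avg p u) v = form m u (avg p v) := by
  have hu1 := finite_support_shift hu 1
  have hu2 := finite_support_shift hu (-1)
  have e1 : form m (avg p u) v =
      ∑' k, m k * p k * u (k + 1) * v k + ∑' k, m k * (1 - p k) * u (k - 1) * v k := by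
    rw [form, ← Summable.tsum_add]
    · congr 1; ext k; simp only [avg]; ring
    · exact summable_of_support_finite hu1 fun k hk => by simp [hk]
    · exact summable_of_support_finite hu2 fun k hk => by
        simp only [← sub_eq_add_neg] at hk; simp [hk]
  have e2 : form m u (avg p v) =
      ∑' k, m k * p k * u k * v (k + 1) + ∑' k, m k * (1 - p k) * u k * v (k - 1) := by
    rw [form, ← Summable.tsum_add]
    · congr 1; ext k; simp only [avg]; ring
    · exact summable_of_support_finite hu fun k hk => by simp [hk]
    · exact summable_of_support_finite hu fun k hk => by simp [hk]
  rw [e1, e2, add_comm]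
  congr 1
  · rw [← tsum_add_one]
    congr 1; ext k; rw [add_sub_cancel_right, hr.balance]
  · rw [← tsum_add_one fun k => m k * (1 - p k) * u k * v (k - 1)]
    congr 1; ext k; rw [add_sub_cancel_right, hr.balance]

/-- Contraction in ℓ²(m): Jensen at each site, then invariance of m, which is self-adjointness
tested against the constant 1. -/
lemma form_avg_self_le {u : ℤ → ℝ} (hu : u.support.Finite) :
    form m (avg p u) (avg p u) ≤ form m u u := by
  have hu' : (fun k => u k ^ 2).support.Finite := hu.subset fun k hk h => hk (by simp [h])
  calc form m (avg p u) (avg p u) ≤ form m (avg p fun k => u k ^ 2) (fun _ => 1) := by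
        refine Summable.tsum_le_tsum (fun k => ?_)
          (summable_of_support_finite (finite_support_avg p hu) fun k hk => by simp [hk])
          (summable_of_support_finite (finite_support_avg p hu') fun k hk => by simp [hk])
        have hp := hr.pos k
        have hq : 0 < 1 - p k := by linarith [hr.lt_one k]
        have : avg p u k * avg p u k ≤ avg p (fun k => u k ^ 2) k := by
          simp only [avg]
          -- The gap in Jensen's inequality is exactly p(1 - p)(u(k+1) - u(k-1))².
          nlinarith [mul_nonneg (mul_nonneg hp.le hq.le) (sq_nonneg (u (k + 1) - u (k - 1)))]
        have := mul_le_mul_of_nonneg_left this (hr.weight_pos k).le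
        linarith
    _ = form m u u := by
        rw [form_avg_left hr hu']
        simp only [form, avg_const]
        congr 1; ext k; ring

omit hr in
lemma form_single (a : ℤ) (u : ℤ → ℝ) : form m u (Pi.single a 1) = m a * u a := by
  rw [form, tsum_eq_single a]
  · simp
  · intro k hk; simp [hk]

lemma form_trans (a b : ℤ) (i j : ℕ) :
    form m (trans p b i) (trans p a j) = m a * trans p b (i + j) a := by
  induction j generalizing i with
  | zero => rw [← form_single]; rfl
  | succ j ih =>
    rw [trans_succ, ← form_avg_left hr (finite_support_trans p b i), ← trans_succ, ih]
    congr 2; ring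

lemma weight_mul_trans_comm (a b : ℤ) (n : ℕ) :
    m a * trans p b n a = m b * trans p a n b := by
  have h1 := form_trans hr a b n 0
  have h2 := form_trans hr b a 0 n
  rw [add_zero] at h1
  rw [zero_add] at h2
  rw [← h1, ← h2, form, form]
  congr 1; ext k; ring

/-- Up to the factor m_b, the return probability at time 2i is the squared norm of `trans p b i`,
and each step contracts the norm. -/
lemma trans_two_mul_antitone (b : ℤ) : Antitone fun i => trans p b (2 * i) b := by
  refine antitone_nat_of_succ_le fun i => ?_
  have h1 := form_trans hr b b i i
  have h2 := form_trans hr b b (i + 1) (i + 1)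
  have h3 := form_avg_self_le hr (finite_support_trans p b i)
  rw [← trans_succ, h1, h2] at h3
  have := le_of_mul_le_mul_left h3 (hr.weight_pos b)
  convert! this using 2 <;> ring

/-- Expand the squared norm of `trans p b i / m b - trans p a i / m a`, which is nonnegative. -/
lemma trans_two_mul_le_add (a b : ℤ) (i : ℕ) :
    2 * (trans p b (2 * i) a / m b) ≤
      trans p b (2 * i) b / m b + trans p a (2 * i) a / m a := by
  have ha := hr.weight_pos a
  have hb := hr.weight_pos b
  set u := trans p b i
  set v := trans p a i
  have hu : u.support.Finite := finite_support_trans p b i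
  have hv : v.support.Finite := finite_support_trans p a i
  have key : 2 * (form m u v / (m a * m b)) ≤ form m u u / m b ^ 2 + form m v v / m a ^ 2 := by
    simp only [form]
    rw [← tsum_div_const, ← tsum_div_const, ← tsum_div_const, ← tsum_mul_left,
      ← Summable.tsum_add]
    · refine Summable.tsum_le_tsum (fun k => ?_) ?_ ?_
      · have : 0 ≤ m k * (u k / m b - v k / m a) ^ 2 := by
          have := (hr.weight_pos k).le; positivity
        have e : m k * (u k / m b - v k / m a) ^ 2 = m k * u k * u k / m b ^ 2 +
            m k * v k * v k / m a ^ 2 - 2 * (m k * u k * v k / (m a * m b)) := by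
          field_simp; ring
        linarith
      · exact summable_of_support_finite hu fun k hk => by simp [hk]
      · exact (summable_of_support_finite hu fun k hk => by simp [hk]).add
          (summable_of_support_finite hv fun k hk => by simp [hk])
    · exact summable_of_support_finite hu fun k hk => by simp [hk]
    · exact summable_of_support_finite hv fun k hk => by simp [hk]
  rw [form_trans hr, form_trans hr, form_trans hr, ← two_mul] at key
  convert! key using 2
  · field_simp
  · field_simp
  · field_simp

/-- Two-sided comparison of the probabilities to be at `b`, started from `a` and from `b`. -/
lemma trans_two_mul_bounds {a b : ℤ} (hab : a ≡ b [ZMOD 2]) {ε : ℝ} (hε4 : ε ≤ 1 / 4)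
    {i : ℕ} (h1 : surv p b (2 * i) a ≤ ε) (h2 : surv p a (2 * i) b ≤ ε) :
    (1 - ε) * trans p b (2 * i) b ≤ trans p b (2 * i) a ∧
      trans p b (2 * i) a ≤ (1 + 2 * ε) * trans p b (2 * i) b := by
  have ha := hr.weight_pos a
  have hb := hr.weight_pos b
  have hε : 0 ≤ ε := (surv_nonneg hr.pos hr.lt_one b (2 * i) a).trans h1
  -- Even return probabilities decrease, so the one at time 2i bounds all earlier ones from below.
  have low : ∀ {c d : ℤ}, d ≡ c [ZMOD 2] → surv p c (2 * i) d ≤ ε →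
      (1 - ε) * trans p c (2 * i) c ≤ trans p c (2 * i) d := by
    intro c d hcd hs
    have hU := trans_nonneg hr.pos hr.lt_one c (2 * i) c
    have := one_sub_surv_mul_le_trans hr.pos hr.lt_one (b := c) (N := 2 * i)
      (U := trans p c (2 * i) c)
      (fun n hn he => by
        obtain ⟨j, rfl⟩ := he
        rw [← two_mul]
        exact trans_two_mul_antitone hr c (show j ≤ i by omega)) (2 * i) le_rfl d (by
          rw [Int.ModEq] at hcd ⊢; push_cast; omega)
    refine le_trans ?_ this
    gcongr
  have l1 := low hab h1
  have l2 := low hab.symm h2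
  refine ⟨l1, ?_⟩
  have hsum := trans_two_mul_le_add hr a b i
  have hcomm := weight_mul_trans_comm hr a b (2 * i)
  have hC : trans p a (2 * i) b / m a = trans p b (2 * i) a / m b := by
    field_simp; linarith
  have l3 : (1 - ε) * (trans p a (2 * i) a / m a) ≤ trans p b (2 * i) a / m b := by
    rw [← hC, ← mul_div_assoc]
    gcongr
  have hA : 0 ≤ trans p b (2 * i) b / m b :=
    div_nonneg (trans_nonneg hr.pos hr.lt_one _ _ _) hb.le
  -- With A, B the normalized return probabilities at b, a and X the mixed one: 2X ≤ A + B and (1 -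
  -- ε)B ≤ X eliminate B.
  have l4 : (1 - 2 * ε) * (trans p b (2 * i) a / m b) ≤
      (1 - ε) * (trans p b (2 * i) b / m b) := by
    nlinarith
  have l5 : trans p b (2 * i) a / m b ≤ (1 + 2 * ε) * (trans p b (2 * i) b / m b) := by
    -- 1 - ε ≤ 1 - 4ε² because ε ≤ 1/4.
    have h5 : (1 - ε) * (trans p b (2 * i) b / m b) ≤
        (1 - 2 * ε) * ((1 + 2 * ε) * (trans p b (2 * i) b / m b)) := by
      have : 0 ≤ (ε - 4 * ε ^ 2) * (trans p b (2 * i) b / m b) :=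
        mul_nonneg (by nlinarith) hA
      nlinarith
    exact le_of_mul_le_mul_left (l4.trans h5) (by linarith)
  rw [← mul_div_assoc] at l5
  exact (div_le_div_iff_of_pos_right hb).1 l5

/-- Starting points in `[-q, q]` of the right parity give nearly the same probability to be at `0`
at time `n`. -/
lemma abs_trans_div_trans_sub_one_le {q : ℕ} {ε : ℝ} (hε4 : ε ≤ 1 / 4)
    {n N : ℕ} (hN : N + 1 ≤ n) (h1 : ∀ a : ℤ, |a| ≤ q + 1 → surv p 0 N a ≤ ε)
    (h2 : ∀ a : ℤ, |a| ≤ q + 1 → surv p a N 0 ≤ ε) {a b : ℤ} (ha : |a| ≤ q) (hb : |b| ≤ q)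
    (han : a ≡ n [ZMOD 2]) (hbn : b ≡ n [ZMOD 2]) :
    0 < trans p 0 n b ∧ |trans p 0 n a / trans p 0 n b - 1| ≤ 4 * ε := by
  have hε : 0 ≤ ε := (surv_nonneg hr.pos hr.lt_one 0 N 0).trans (h1 0 (by simp; positivity))
  obtain ⟨U, hU, hbd⟩ : ∃ U : ℝ, 0 < U ∧ ∀ c : ℤ, |c| ≤ q → c ≡ n [ZMOD 2] →
      (1 - ε) * U ≤ trans p 0 n c ∧ trans p 0 n c ≤ (1 + 2 * ε) * U := by
    have main : ∀ i, N ≤ 2 * i → ∀ c : ℤ, |c| ≤ q + 1 → c ≡ 0 [ZMOD 2] →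
        (1 - ε) * trans p 0 (2 * i) 0 ≤ trans p 0 (2 * i) c ∧
          trans p 0 (2 * i) c ≤ (1 + 2 * ε) * trans p 0 (2 * i) 0 := fun i hi c hc hc2 =>
      trans_two_mul_bounds hr hc2 hε4
        ((surv_antitone hr.pos hr.lt_one 0 c hi).trans (h1 c hc))
        ((surv_antitone hr.pos hr.lt_one c 0 hi).trans (h2 c hc))
    obtain ⟨i, rfl | rfl⟩ := Nat.even_or_odd' n
    · refine ⟨_, trans_two_mul_pos hr.pos hr.lt_one 0 i, fun c hc hcn => ?_⟩
      refine main i (by omega) c (by omega) ?_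
      rw [Int.ModEq] at hcn ⊢; push_cast at hcn; omega
    -- At an odd time, condition on the first step: c ± 1 are even and at most q + 1 in absolute
    -- value, and one unit of time is lost. This accounts for q + 1 and N + 1 in the hypotheses.
    · refine ⟨_, trans_two_mul_pos hr.pos hr.lt_one 0 i, fun c hc hcn => ?_⟩
      have hl := main i (by omega) (c - 1) (by rw [abs_le] at hc ⊢; omega) (by
        rw [Int.ModEq] at hcn ⊢; push_cast at hcn; omega)
      have hg := main i (by omega) (c + 1) (by rw [abs_le] at hc ⊢; omega) (by
        rw [Int.ModEq] at hcn ⊢; push_cast at hcn; omega)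
      rw [trans_succ]
      refine ⟨?_, ?_⟩
      · conv_lhs => rw [← avg_const p ((1 - ε) * trans p 0 (2 * i) 0) c]
        exact avg_mono (hr.pos c).le (hr.lt_one c).le hg.1 hl.1
      · conv_rhs => rw [← avg_const p ((1 + 2 * ε) * trans p 0 (2 * i) 0) c]
        exact avg_mono (hr.pos c).le (hr.lt_one c).le hg.2 hl.2
  obtain ⟨a1, a2⟩ := hbd a ha han
  obtain ⟨b1, b2⟩ := hbd b hb hbn
  have hpos : 0 < trans p 0 n b := lt_of_lt_of_le (by nlinarith) b1
  refine ⟨hpos, ?_⟩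
  rw [div_sub_one hpos.ne', abs_div, abs_of_pos hpos, div_le_iff₀ hpos]
  -- The two bounds differ by 3εU, and 3 ≤ 4(1 - ε).
  have h3 : 3 * ε * U ≤ 4 * ε * trans p 0 n b := by
    have : 3 * (ε * U) ≤ 4 * (ε * ((1 - ε) * U)) := by
      have : 0 ≤ ε * U * (1 - 4 * ε) := mul_nonneg (by positivity) (by linarith)
      nlinarith
    nlinarith [mul_le_mul_of_nonneg_left b1 hε]
  rw [abs_le]
  constructor <;> linarith

end Form

/-! ### Recurrence from a potential bounded above along two sequences. -/

lemma tendsto_sub_of_monotone_bounded {g : ℕ → ℝ} (hg : Monotone g) {C : ℝ} (hC : ∀ n, g n ≤ C) :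
    Tendsto (fun n => g (n + 1) - g n) atTop (𝓝 0) := by
  obtain ⟨L, hL⟩ : ∃ L, Tendsto g atTop (𝓝 L) :=
    ⟨_, tendsto_atTop_ciSup hg ⟨C, by rintro _ ⟨n, rfl⟩; exact hC n⟩⟩
  simpa using ((tendsto_add_atTop_iff_nat 1).2 hL).sub hL

/-- Maximum principle on a half-line: a bounded nonnegative function vanishing at the origin, whose
differences weighted by `exp W` are constant, vanishes if `W` does not tend to `∞`. -/
lemma eq_zero_of_weighted_diff_const {g W : ℕ → ℝ} (h0 : g 0 = 0) (hg : ∀ n, 0 ≤ g n)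
    {B : ℝ} (hB : ∀ n, g n ≤ B) {C : ℝ} (hW : ∃ᶠ n in atTop, W n ≤ C)
    (h : ∀ n, (g (n + 2) - g (n + 1)) * Real.exp (W (n + 1)) =
      (g (n + 1) - g n) * Real.exp (W n)) (n : ℕ) : g n = 0 := by
  have hc : ∀ n, (g (n + 1) - g n) * Real.exp (W n) = g 1 * Real.exp (W 0) := by
    intro n
    induction n with
    | zero => simp [h0]
    | succ n ih => rw [h, ih]
  have hd : ∀ n, g (n + 1) - g n = g 1 * Real.exp (W 0) * Real.exp (-W n) := fun n => by
    rw [← hc n, mul_assoc, ← Real.exp_add]; simp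
  have hmono : Monotone g := monotone_nat_of_le_succ fun n => by
    have : 0 ≤ g (n + 1) - g n := by rw [hd]; have := hg 1; positivity
    linarith
  have hlim := tendsto_sub_of_monotone_bounded hmono hB
  -- Otherwise infinitely many increments would be at least a fixed positive multiple of exp(-C).
  have hz : g 1 * Real.exp (W 0) = 0 := by
    by_contra hne
    have hpos : 0 < g 1 * Real.exp (W 0) :=
      lt_of_le_of_ne (mul_nonneg (hg 1) (Real.exp_pos _).le) (Ne.symm hne)
    have hev := hlim.eventually_lt_const (mul_pos hpos (Real.exp_pos (-C)))
    obtain ⟨k, hk1, hk2⟩ := (hW.and_eventually hev).exists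
    rw [hd] at hk2
    have := lt_of_mul_lt_mul_left hk2 hpos.le
    rw [Real.exp_lt_exp] at this
    linarith
  induction n with
  | zero => exact h0
  | succ n ih =>
    have := hd n
    rw [hz, ih] at this
    simpa using this

/-- The walk with drift potential `V` is recurrent if `V` stays bounded above along sequences tending to
`∞` and to `-∞`. -/
lemma tendsto_surv_zero {p V : ℤ → ℝ} (h0 : ∀ k, 0 < p k) (h1 : ∀ k, p k < 1)
    (hV : ∀ k, p k = Real.exp (V (k + 1) - V k) * (1 - p k)) {C : ℝ}
    (hr : ∃ᶠ n : ℕ in atTop, V n ≤ C) (hl : ∃ᶠ n : ℕ in atTop, V (-n) ≤ C) (b k : ℤ) :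
    Tendsto (fun n => surv p b n k) atTop (𝓝 0) := by
  -- The limit g is the probability of never visiting b; it is harmonic off b.
  choose g hg using fun k : ℤ => (⟨_, tendsto_atTop_ciInf (surv_antitone h0 h1 b k)
    ⟨0, by rintro _ ⟨n, rfl⟩; exact surv_nonneg h0 h1 b n k⟩⟩ :
      ∃ L, Tendsto (fun n => surv p b n k) atTop (𝓝 L))
  have g0 : ∀ k, 0 ≤ g k := fun k => ge_of_tendsto' (hg k) fun n => surv_nonneg h0 h1 b n k
  have g1 : ∀ k, g k ≤ 1 := fun k => le_of_tendsto' (hg k) fun n => surv_le_one h0 h1 b n k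
  have gb : g b = 0 := tendsto_nhds_unique (hg b) (by simp)
  have gharm : ∀ k, k ≠ b → g k = avg p g k := fun k hk => by
    refine tendsto_nhds_unique ((tendsto_add_atTop_iff_nat 1).2 (hg k)) ?_
    simp only [surv_succ_of_ne p hk]
    exact ((hg _).const_mul _).add ((hg _).const_mul _)
  have gdiff : ∀ k, k ≠ b → (g (k + 1) - g k) * Real.exp (V (k + 1)) =
      (g k - g (k - 1)) * Real.exp (V k) := fun k hk => by
    have hh := gharm k hk
    have hp := hV k
    have hq : 0 < 1 - p k := by linarith [h1 k]
    rw [Real.exp_sub, div_mul_eq_mul_div, eq_div_iff (Real.exp_pos _).ne'] at hp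
    have h3 : p k * (g (k + 1) - g k) = (1 - p k) * (g k - g (k - 1)) := by
      simp only [avg] at hh; linarith
    refine mul_left_cancel₀ hq.ne' ?_
    linear_combination Real.exp (V k) * h3 - (g (k + 1) - g k) * hp
  suffices g k = 0 by rw [← this]; exact hg k
  have shift : ∀ {P : ℤ → Prop} (σ : ℤ), (∃ᶠ n : ℕ in atTop, P (σ * n)) → ∀ c : ℤ,
      ∃ᶠ n : ℕ in atTop, P (σ * (n + c)) := by
    intro P σ hP c
    rw [frequently_atTop] at hP ⊢
    intro N
    obtain ⟨n, hn, hn'⟩ := hP (N + c.natAbs)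
    refine ⟨(n - c).toNat, by omega, ?_⟩
    rwa [Int.toNat_of_nonneg (by omega), sub_add_cancel]
  rcases le_total b k with hbk | hbk
  -- In `gdiff` the difference g(k) - g(k-1) carries the weight exp V(k), hence the offset by one on
  -- the right of b and none on the left.
  · have := eq_zero_of_weighted_diff_const (g := fun n : ℕ => g (b + n))
      (W := fun n : ℕ => V (b + n + 1)) (by simpa using gb) (fun n => g0 _) (fun n => g1 _)
      (C := C) ((shift (P := fun k => V k ≤ C) 1 (by simpa using hr) (b + 1)).mono fun n hn => by
        convert! hn using 2; ring)
      (fun n => by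
        have := gdiff (b + n + 1) (by omega)
        rw [add_sub_cancel_right] at this
        push_cast
        rw [show b + ((n : ℤ) + 2) = b + n + 1 + 1 by ring, ← add_assoc b (n : ℤ) 1]
        exact this) (k - b).toNat
    rwa [Int.toNat_of_nonneg (by omega), add_sub_cancel] at this
  · have := eq_zero_of_weighted_diff_const (g := fun n : ℕ => g (b - n))
      (W := fun n : ℕ => V (b - n)) (by simpa using gb) (fun n => g0 _) (fun n => g1 _)
      (C := C) ((shift (P := fun k => V k ≤ C) (-1) (by simpa using hl) (-b)).mono fun n hn => by
        convert! hn using 2; ring)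
      (fun n => by
        have := gdiff (b - n - 1) (by omega)
        rw [sub_add_cancel] at this
        push_cast
        rw [show b - ((n : ℤ) + 2) = b - n - 1 - 1 by ring,
          show b - ((n : ℤ) + 1) = b - n - 1 by ring]
        linarith) (b - k).toNat
    rwa [Int.toNat_of_nonneg (by omega), sub_sub_cancel] at this

/-! ### The Denjoy–Koksma inequality. -/

/-- A function of bounded variation on the circle is controlled, on a long interval of the line, by
the increments of a monotone function. -/
lemma CircleBV.exists_monotoneOn {f : UnitAddCircle → ℝ} (h : CircleBV f) :
    ∃ W : ℝ → ℝ, MonotoneOn W (Set.Icc (-1) 2) ∧ ∀ y ∈ Set.Icc (-1 : ℝ) 2, ∀ z ∈ Set.Icc (-1 : ℝ) 2,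
      y ≤ z → |f (z : UnitAddCircle) - f (y : UnitAddCircle)| ≤ W z - W y := by
  set F : ℝ → ℝ := fun t => f (t : UnitAddCircle) with hF
  have hper : ∀ (c : ℤ) (t : ℝ), F (t + c) = F t := fun c t => by simp [hF]
  have htr : ∀ c : ℤ, eVariationOn F (Set.Icc (c : ℝ) (c + 1)) ≠ ∞ := fun c => by
    have h1 := eVariationOn.comp_eq_of_monotoneOn F (t := Set.Icc (0 : ℝ) 1) (fun t : ℝ => t + c)
      (fun a _ b _ hab => by simpa using hab)
    have h2 : F ∘ (fun t : ℝ => t + c) = F := funext fun t => hper c t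
    rw [h2, Set.image_add_const_Icc, zero_add, add_comm] at h1
    rw [← h1]
    exact h
  have hbv : BoundedVariationOn F (Set.Icc (-1) 2) := by
    have e1 := eVariationOn.Icc_add_Icc F (s := Set.univ) (a := -1) (b := 0) (c := 1)
      (by norm_num) (by norm_num) trivial
    have e2 := eVariationOn.Icc_add_Icc F (s := Set.univ) (a := -1) (b := 1) (c := 2)
      (by norm_num) (by norm_num) trivial
    simp only [Set.univ_inter] at e1 e2
    rw [BoundedVariationOn, ← e2, ← e1]
    have a1 := htr (-1)
    have a2 := htr 0
    have a3 := htr 1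
    norm_num at a1 a2 a3
    simp [a1, a2, a3]
  -- Jordan decomposition F = P - Q; the increments of P + Q dominate those of F.
  obtain ⟨P, Q, hP, hQ, hPQ⟩ :=
    hbv.locallyBoundedVariationOn.exists_monotoneOn_sub_monotoneOn
  refine ⟨P + Q, hP.add hQ, fun y hy z hz hyz => ?_⟩
  have := hP hy hz hyz
  have := hQ hy hz hyz
  have e : ∀ t : ℝ, f (t : UnitAddCircle) = P t - Q t := fun t => congrFun hPQ t
  rw [e, e, abs_le]
  simp only [Pi.add_apply]
  constructor <;> linarith

/-- One term of the Denjoy–Koksma inequality. -/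
lemma abs_sub_mul_integral_le {F : ℝ → ℝ} (hF : Continuous F) {a b h M : ℝ} (hh : 0 < h) (hab : b = a + h)
    {y : ℝ} (hM : ∀ z ∈ Set.Icc a b, |F y - F z| ≤ M) :
    |F y - h⁻¹ * ∫ z in a..b, F z| ≤ M := by
  subst hab
  have h1 : F y - h⁻¹ * ∫ z in a..(a + h), F z = h⁻¹ * ∫ z in a..(a + h), (F y - F z) := by
    rw [intervalIntegral.integral_sub intervalIntegrable_const (hF.intervalIntegrable _ _)]
    simp; field_simp
  have h2 := intervalIntegral.norm_integral_le_of_norm_le_const (a := a) (b := a + h)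
    (f := fun z => F y - F z) (C := M) fun z hz => by
      rw [Set.uIoc_of_le (by linarith)] at hz
      exact hM z (Set.Ioc_subset_Icc_self hz)
  rw [h1, abs_mul, abs_of_pos (inv_pos.2 hh), inv_mul_le_iff₀ hh]
  rw [add_sub_cancel_left, abs_of_pos hh, Real.norm_eq_abs] at h2
  linarith

/-- Multiplication by a unit permutes the residues modulo q. -/
lemma sum_range_mul_mod {q : ℕ} (hq : 0 < q) {p : ℤ} (hpq : IsCoprime p q) (g : ℕ → ℝ) :
    ∑ k ∈ Finset.range q, g ((k * p % q).toNat) = ∑ r ∈ Finset.range q, g r := by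
  have hq' : (0 : ℤ) < q := by exact_mod_cast hq
  have hinj : Set.InjOn (fun k : ℕ => ((k * p % q : ℤ)).toNat) (Finset.range q : Set ℕ) := by
    intro k hk l hl hkl
    simp only [Finset.coe_range, Set.mem_Iio] at hk hl
    have h1 := Int.emod_nonneg (k * p) hq'.ne'
    have h2 := Int.emod_nonneg (l * p) hq'.ne'
    have h3 : (k * p : ℤ) ≡ l * p [ZMOD q] := by
      simp only at hkl
      rw [Int.ModEq]; omega
    have h4 : (q : ℤ) ∣ (l - k) * p := by
      rw [sub_mul]; exact h3.dvd
    have h5 := hpq.symm.dvd_of_dvd_mul_right h4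
    have h6 := Int.eq_zero_of_abs_lt_dvd h5 (by rw [abs_lt]; constructor <;> omega)
    omega
  have himg : (Finset.range q).image (fun k : ℕ => ((k * p % q : ℤ)).toNat) = Finset.range q := by
    refine Finset.eq_of_subset_of_card_le (fun r hr => ?_) ?_
    · obtain ⟨k, -, rfl⟩ := Finset.mem_image.1 hr
      have h1 := Int.emod_nonneg (k * p) hq'.ne'
      have h2 := Int.emod_lt_of_pos (k * p) hq'
      rw [Finset.mem_range]; omega
    · rw [Finset.card_image_of_injOn hinj]
  conv_rhs => rw [← himg]
  rw [Finset.sum_image hinj]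

/-- **Denjoy–Koksma inequality**, with a constant which is not optimal. -/
theorem exists_abs_birkhoff_le {α : ℝ} (hα : Irrational α) {f : UnitAddCircle → ℝ}
    (hf : Continuous f) (hBV : CircleBV f) (hmean : ∫ z, f z = 0) :
    ∃ C : ℝ, ∀ N : ℕ, ∃ q : ℕ, N ≤ q ∧ ∀ x : UnitAddCircle,
      |∑ k ∈ Finset.range q, f (site α x k)| ≤ C := by
  obtain ⟨W, hW, hfW⟩ := hBV.exists_monotoneOn
  refine ⟨2 * (W 2 - W (-1)), fun N => ?_⟩
  -- Dirichlet approximation gives infinitely many such ρ, while only finitely many have denominator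
  -- below N, since their numerators are bounded too.
  obtain ⟨ρ, hρ, hρN⟩ : ∃ ρ : ℚ, |α - ρ| < 1 / (ρ.den : ℝ) ^ 2 ∧ N ≤ ρ.den := by
    by_contra! hcon
    refine Real.infinite_rat_abs_sub_lt_one_div_den_sq_of_irrational hα ?_
    have hfin : ({n : ℤ | |n| ≤ N * ⌈|α| + 1⌉} ×ˢ {d : ℕ | d < N}).Finite := by
      refine Set.Finite.prod ?_ (Set.finite_lt_nat N)
      refine (Set.finite_Icc (-(N * ⌈|α| + 1⌉)) (N * ⌈|α| + 1⌉)).subset fun n hn => ?_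
      exact abs_le.1 hn
    refine Set.Finite.of_finite_image (f := fun ρ : ℚ => (ρ.num, ρ.den)) (hfin.subset ?_) ?_
    · rintro _ ⟨ρ, hρ, rfl⟩
      have hd := hcon ρ hρ
      refine ⟨?_, hd⟩
      have hden : (1 : ℝ) ≤ ρ.den := by exact_mod_cast ρ.pos
      have h1 : |(ρ : ℝ)| ≤ |α| + 1 := by
        have h2 : |α - ρ| ≤ 1 := hρ.le.trans (by
          rw [div_le_one (by positivity)]; nlinarith)
        have := abs_sub_abs_le_abs_sub (ρ : ℝ) α
        rw [abs_sub_comm] at this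
        linarith
      have h3 : (ρ.num : ℝ) = ρ * ρ.den := by
        exact_mod_cast (Rat.mul_den_eq_num ρ).symm
      have h4 : |(ρ.num : ℝ)| ≤ N * ⌈|α| + 1⌉ := by
        rw [h3, abs_mul, mul_comm, Nat.abs_cast]
        have : (ρ.den : ℝ) ≤ N := by exact_mod_cast hd.le
        have := Int.le_ceil (|α| + 1)
        gcongr
        linarith
      exact_mod_cast h4
    · intro a _ b _ hab
      simp only [Prod.mk.injEq] at hab
      exact Rat.ext hab.1 hab.2
  set q := ρ.den with hq
  have hqpos : 0 < q := ρ.pos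
  have hqR : (0 : ℝ) < q := by exact_mod_cast hqpos
  have hq1 : (1 : ℝ) ≤ q := by exact_mod_cast hqpos
  have hinv : (q : ℝ)⁻¹ ≤ 1 := inv_le_one_of_one_le₀ hq1
  have hinv0 : (0 : ℝ) < (q : ℝ)⁻¹ := inv_pos.2 hqR
  have hcop : IsCoprime ρ.num (q : ℤ) := by
    rw [Int.isCoprime_iff_nat_coprime]; simpa using ρ.reduced
  have hρq : (ρ : ℝ) = ρ.num / q := by
    rw [hq]; exact_mod_cast (Rat.num_div_den ρ).symm
  refine ⟨q, hρN, fun x => ?_⟩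
  obtain ⟨t, ⟨ht0, ht1⟩, rfl⟩ : ∃ t ∈ Set.Ico (0 : ℝ) 1, (t : UnitAddCircle) = x := by
    have := AddCircle.coe_image_Ico_eq (1 : ℝ) 0
    have hx : x ∈ ((↑) : ℝ → UnitAddCircle) '' Set.Ico 0 (0 + 1) := by rw [this]; trivial
    simpa using hx
  set F : ℝ → ℝ := fun s => f (s : UnitAddCircle) with hF
  have hFc : Continuous F := hf.comp (AddCircle.continuous_mk' 1)
  set e : ℕ → ℝ := fun r => t + r * (q : ℝ)⁻¹ with he
  have heb : ∀ r ∈ Finset.range q, t ≤ e r ∧ e (r + 1) ≤ t + 1 := fun r hr => by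
    have h2 : (r + 1 : ℝ) ≤ q := by exact_mod_cast Finset.mem_range.1 hr
    have : (r + 1 : ℝ) * (q : ℝ)⁻¹ ≤ 1 := by
      rw [← div_eq_mul_inv, div_le_one hqR]; exact h2
    simp only [he]; push_cast
    refine ⟨by have : (0 : ℝ) ≤ r * (q : ℝ)⁻¹ := by positivity
               linarith, by linarith⟩
  have hes : ∀ r : ℕ, e (r + 1) = e r + (q : ℝ)⁻¹ := fun r => by
    simp only [he]; push_cast; ring
  -- the error of one term
  have hterm : ∀ k ∈ Finset.range q, ∀ r : ℕ, r = ((k * ρ.num % q : ℤ)).toNat →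
      |f (site α t k) - (q : ℝ) * ∫ z in e r..e (r + 1), F z| ≤
        W (e (r + 1)) - W (e r - (q : ℝ)⁻¹) := by
    intro k hk r hr
    have hq' : (0 : ℤ) < q := by exact_mod_cast hqpos
    have n1 := Int.emod_nonneg (k * ρ.num) hq'.ne'
    have n2 := Int.emod_lt_of_pos (k * ρ.num) hq'
    have hrq : r ∈ Finset.range q := by rw [Finset.mem_range]; omega
    obtain ⟨b1, b2⟩ := heb r hrq
    have hdiv : (k * ρ.num : ℤ) = q * (k * ρ.num / q) + r := by
      have := Int.mul_ediv_add_emod (k * ρ.num) q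
      omega
    set j : ℤ := k * ρ.num / q
    have hdivR : (k * ρ.num : ℝ) = q * j + r := by exact_mod_cast hdiv
    -- Modulo 1, kα is r/q + θ with |θ| ≤ 1/q because k < q. So the orbit point and the cell [e r, e
    -- (r+1)] both lie in [e r - 1/q, e (r+1)], where W controls the oscillation.
    set θ := k * (α - ρ) with hθ
    have hkq : (k : ℝ) < q := by exact_mod_cast Finset.mem_range.1 hk
    have hθ1 : |θ| ≤ (q : ℝ)⁻¹ := by
      rw [hθ, abs_mul, Nat.abs_cast]
      calc (k : ℝ) * |α - ρ| ≤ q * (1 / (q : ℝ) ^ 2) := by gcongr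
        _ = (q : ℝ)⁻¹ := by field_simp
    obtain ⟨θl, θr⟩ := abs_le.1 hθ1
    have hsite : f (site α t k) = F (e r + θ) := by
      have hα' : (k : ℝ) * α = j + (r * (q : ℝ)⁻¹ + θ) := by
        have : (k : ℝ) * ρ = j + r * (q : ℝ)⁻¹ := by
          rw [hρq]; field_simp; linarith
        rw [hθ, mul_sub, this]; ring
      have hj : ((j : ℝ) : UnitAddCircle) = 0 := by
        rw [AddCircle.coe_eq_zero_iff]; exact ⟨j, by simp⟩
      simp only [hF, site, Int.cast_natCast, hα', he]
      rw [AddCircle.coe_add, hj, zero_add, ← AddCircle.coe_add, add_assoc]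
    rw [hsite]
    have := abs_sub_mul_integral_le hFc (a := e r) (b := e (r + 1)) (h := (q : ℝ)⁻¹)
      (y := e r + θ) (M := W (e (r + 1)) - W (e r - (q : ℝ)⁻¹)) hinv0 (hes r) ?_
    · simpa using this
    · intro z hz
      have hlo : e r - (q : ℝ)⁻¹ ∈ Set.Icc (-1 : ℝ) 2 := ⟨by linarith, by linarith [hes r]⟩
      have hhi : e (r + 1) ∈ Set.Icc (-1 : ℝ) 2 := ⟨by linarith [hes r], by linarith⟩
      have hes' := hes r
      have hy : e r + θ ∈ Set.Icc (-1 : ℝ) 2 := ⟨by linarith, by linarith⟩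
      have hz' : z ∈ Set.Icc (-1 : ℝ) 2 := ⟨by linarith [hz.1], by linarith [hz.2]⟩
      rcases le_total z (e r + θ) with h | h
      · have := hfW z hz' _ hy h
        have := hW hlo hz' (by linarith [hz.1])
        have := hW hy hhi (by linarith)
        simp only [hF]; linarith
      · have := hfW _ hy z hz' h
        have := hW hlo hy (by linarith)
        have := hW hz' hhi hz.2
        rw [abs_sub_comm]
        simp only [hF]; linarith
  -- summing up
  have hint : ∑ r ∈ Finset.range q, (q : ℝ) * ∫ z in e r..e (r + 1), F z = 0 := by
    rw [← Finset.mul_sum, intervalIntegral.sum_integral_adjacent_intervals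
      fun k _ => hFc.intervalIntegrable _ _]
    have e0 : e 0 = t := by simp [he]
    have eq1 : e q = t + 1 := by simp [he, hqR.ne']
    rw [e0, eq1, UnitAddCircle.intervalIntegral_preimage t f, hmean, mul_zero]
  have hsum : ∑ k ∈ Finset.range q, f (site α t k) = ∑ k ∈ Finset.range q,
      (f (site α t k) - (q : ℝ) * ∫ z in e ((k * ρ.num % q : ℤ)).toNat..
        e (((k * ρ.num % q : ℤ)).toNat + 1), F z) := by
    rw [Finset.sum_sub_distrib,
      sum_range_mul_mod hqpos hcop fun r => (q : ℝ) * ∫ z in e r..e (r + 1), F z, hint, sub_zero]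
  have hmem : ∀ s, -1 ≤ s → s ≤ 2 → s ∈ Set.Icc (-1 : ℝ) 2 := fun s h1 h2 => ⟨h1, h2⟩
  rw [hsum]
  calc _ ≤ ∑ k ∈ Finset.range q, (fun r : ℕ => W (e (r + 1)) - W (e r - (q : ℝ)⁻¹))
        ((k * ρ.num % q : ℤ)).toNat :=
        (Finset.abs_sum_le_sum_abs _ _).trans (Finset.sum_le_sum fun k hk => hterm k hk _ rfl)
    _ = ∑ r ∈ Finset.range q, (W (e (r + 1)) - W (e r - (q : ℝ)⁻¹)) :=
        sum_range_mul_mod hqpos hcop fun r => W (e (r + 1)) - W (e r - (q : ℝ)⁻¹)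
    -- Each increment spans two adjacent cells; splitting it gives two telescoping sums, hence the
    -- factor 2 in the constant.
    _ = ∑ r ∈ Finset.range q, ((W (e (r + 1)) - W (e r)) +
          (W (e (r + 1) - (q : ℝ)⁻¹) - W (e r - (q : ℝ)⁻¹))) := by
        refine Finset.sum_congr rfl fun r _ => ?_
        rw [show e (r + 1) - (q : ℝ)⁻¹ = e r by rw [hes]; ring]; ring
    _ = (W (e q) - W (e 0)) + (W (e q - (q : ℝ)⁻¹) - W (e 0 - (q : ℝ)⁻¹)) := by
        rw [Finset.sum_add_distrib, Finset.sum_range_sub (fun r => W (e r)),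
          Finset.sum_range_sub (fun r => W (e r - (q : ℝ)⁻¹))]
    _ ≤ 2 * (W 2 - W (-1)) := by
        have e0 : e 0 = t := by simp [he]
        have eq1 : e q = t + 1 := by simp [he, hqR.ne']
        rw [e0, eq1]
        have l := hmem (-1) (by norm_num) (by norm_num)
        have u := hmem 2 (by norm_num) (by norm_num)
        have := hW (hmem (t + 1) (by linarith) (by linarith)) u (by linarith)
        have := hW (hmem (t + 1 - (q : ℝ)⁻¹) (by linarith) (by linarith)) u (by linarith)
        have := hW l (hmem t (by linarith) (by linarith)) (by linarith)
        have := hW l (hmem (t - (q : ℝ)⁻¹) (by linarith) (by linarith)) (by linarith)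
        linarith

/-! ### The law on path space, time reversal and excursions. -/

/-- The probabilities of the steps to the right in the environment `(𝔭, α, x)`. -/
noncomputable def envProb (f : UnitAddCircle → ℝ) (α : ℝ) (x : UnitAddCircle) (k : ℤ) : ℝ :=
  rightProb f (site α x k)

/-- The probability that the walk started at `k` visits `b` for the first time at time `n ≥ 0`. -/
noncomputable def hit (p : ℤ → ℝ) (b : ℤ) : ℕ → ℤ → ℝ
  | 0 => fun k => if k = b then 1 else 0
  | n + 1 => fun k => if k = b then 0 else avg p (hit p b n) k

lemma sum_hit (p : ℤ → ℝ) (b : ℤ) (n : ℕ) (k : ℤ) :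
    ∑ i ∈ Finset.range (n + 1), hit p b i k = 1 - surv p b n k := by
  induction n generalizing k with
  | zero => simp only [hit, surv, Finset.sum_range_one, zero_add]; split_ifs <;> norm_num
  | succ n ih =>
    rw [Finset.sum_range_succ']
    by_cases h : k = b
    · simp [hit, h]
    · rw [surv_succ_of_ne p h]
      have : ∑ i ∈ Finset.range (n + 1), hit p b (i + 1) k =
          p k * (∑ i ∈ Finset.range (n + 1), hit p b i (k + 1)) +
            (1 - p k) * ∑ i ∈ Finset.range (n + 1), hit p b i (k - 1) := by
        rw [Finset.mul_sum, Finset.mul_sum, ← Finset.sum_add_distrib]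
        exact Finset.sum_congr rfl fun i _ => by simp [hit, h, avg]
      rw [this, ih, ih]
      simp only [hit, h, avg, if_false]
      ring

section Law

variable (f : UnitAddCircle → ℝ) (α : ℝ) (x : UnitAddCircle)

instance : IsProbabilityMeasure (walkLaw f α x) := by
  unfold walkLaw; infer_instance

/-- Indicators in the departure site k integrate to the probabilities of being at either neighbour
of b. -/
lemma stepLaw_singleton (k b : ℤ) : stepLaw f α x k {b} =
    ENNReal.ofReal (envProb f α x (b - 1)) * ({b - 1} : Set ℤ).indicator 1 k +
      ENNReal.ofReal (1 - envProb f α x (b + 1)) * ({b + 1} : Set ℤ).indicator 1 k := by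
  simp only [stepLaw, Measure.add_apply, Measure.smul_apply, smul_eq_mul,
    Measure.dirac_apply' _ (measurableSet_singleton b)]
  congr 1
  · by_cases h : k = b - 1
    · subst h; simp [envProb]
    · have : k + 1 ≠ b := by omega
      simp [h, this]
  · by_cases h : k = b + 1
    · subst h; simp [envProb, leftProb]
    · have : k - 1 ≠ b := by omega
      simp [h, this]

/-- The Markov property, for events which depend on the walk up to time `n`. -/
lemma walkLaw_and_succ_eq {n : ℕ} {S : Set (Finset.Iic n → ℤ)} (hS : MeasurableSet S) (b : ℤ) :
    walkLaw f α x {ω | Preorder.frestrictLe (π := fun _ => ℤ) n ω ∈ S ∧ ω (n + 1) = b} =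
      ENNReal.ofReal (envProb f α x (b - 1)) *
          walkLaw f α x {ω | Preorder.frestrictLe (π := fun _ => ℤ) n ω ∈ S ∧ ω n = b - 1} +
        ENNReal.ofReal (1 - envProb f α x (b + 1)) *
          walkLaw f α x {ω | Preorder.frestrictLe (π := fun _ => ℤ) n ω ∈ S ∧ ω n = b + 1} := by
  set κ := historyKernel f α x
  set x₀ : Finset.Iic 0 → ℤ := fun _ => 0
  set ν := Kernel.partialTraj (X := fun _ => ℤ) κ 0 n x₀ with hν
  have hT : ∀ c : ℤ, MeasurableSet {ω : ℕ → ℤ | ω (n + 1) = c} := fun c =>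
    measurableSet_eq_fun (measurable_pi_apply (n + 1)) measurable_const
  have hlast : Measurable fun h : Finset.Iic n → ℤ => h ⟨n, Finset.mem_Iic.2 le_rfl⟩ :=
    measurable_pi_apply _
  have hm : Measurable fun ω : ℕ → ℤ => (Preorder.frestrictLe (π := fun _ => ℤ) n ω, ω) := by
    fun_prop
  have hmap : ∀ c : ℤ, walkLaw f α x
      {ω | Preorder.frestrictLe (π := fun _ => ℤ) n ω ∈ S ∧ ω n = c} =
      ν (S ∩ (fun h => h ⟨n, Finset.mem_Iic.2 le_rfl⟩) ⁻¹' {c}) := fun c => by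
    rw [hν, ← Kernel.traj_map_frestrictLe_apply, Measure.map_apply (by fun_prop)
      (hS.inter (hlast (measurableSet_singleton c)))]
    rfl
  rw [hmap, hmap]
  calc _ = (walkLaw f α x).map (fun ω => (Preorder.frestrictLe (π := fun _ => ℤ) n ω, ω))
        (S ×ˢ {ω : ℕ → ℤ | ω (n + 1) = b}) := by
        rw [Measure.map_apply hm (hS.prod (hT b))]; rfl
    -- Disintegrate the path law along the history up to time n.
    _ = (ν ⊗ₘ Kernel.traj (X := fun _ => ℤ) κ n) (S ×ˢ {ω : ℕ → ℤ | ω (n + 1) = b}) := by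
        rw [hν, Kernel.partialTraj_compProd_traj (Nat.zero_le n)]; rfl
    _ = ∫⁻ h in S, stepLaw f α x (h ⟨n, Finset.mem_Iic.2 le_rfl⟩) {b} ∂ν := by
        rw [Measure.compProd_apply_prod hS (hT b)]
        refine setLIntegral_congr_fun hS fun h _ => ?_
        have h1 := Kernel.map_traj_succ_self (X := fun _ => ℤ) (κ := κ) (a := n)
        have h2 := congrArg (fun η => η h {b}) h1
        rw [Kernel.map_apply' _ (by fun_prop) _ (measurableSet_singleton b)] at h2
        exact h2
    _ = _ := by
        simp only [stepLaw_singleton]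
        have hi : ∀ c : ℤ, Measurable fun h : Finset.Iic n → ℤ =>
            ({c} : Set ℤ).indicator (1 : ℤ → ℝ≥0∞) (h ⟨n, Finset.mem_Iic.2 le_rfl⟩) := fun c =>
          (measurable_one.indicator (measurableSet_singleton c)).comp hlast
        have hl : ∀ c : ℤ, ∫⁻ h in S, ({c} : Set ℤ).indicator (1 : ℤ → ℝ≥0∞)
            (h ⟨n, Finset.mem_Iic.2 le_rfl⟩) ∂ν =
              ν (S ∩ (fun h => h ⟨n, Finset.mem_Iic.2 le_rfl⟩) ⁻¹' {c}) := fun c => by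
          have e : (fun h : Finset.Iic n → ℤ => ({c} : Set ℤ).indicator (1 : ℤ → ℝ≥0∞)
            (h ⟨n, Finset.mem_Iic.2 le_rfl⟩)) =
              ((fun h : Finset.Iic n → ℤ => h ⟨n, Finset.mem_Iic.2 le_rfl⟩) ⁻¹' {c}).indicator 1 :=
            rfl
          rw [e, lintegral_indicator_one (hlast (measurableSet_singleton c)),
            Measure.restrict_apply (hlast (measurableSet_singleton c)), Set.inter_comm]
        rw [lintegral_add_left ((hi _).const_mul _), lintegral_const_mul _ (hi _),
          lintegral_const_mul _ (hi _), hl, hl]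

lemma envProb_pos (k : ℤ) : 0 < envProb f α x k := by
  unfold envProb rightProb; positivity

lemma envProb_lt_one (k : ℤ) : envProb f α x k < 1 := by
  unfold envProb rightProb
  rw [div_lt_one (by positivity)]
  linarith

lemma walkLaw_real_and_succ_eq {n : ℕ} {S : Set (Finset.Iic n → ℤ)} (hS : MeasurableSet S)
    (b : ℤ) :
    (walkLaw f α x).real {ω | Preorder.frestrictLe (π := fun _ => ℤ) n ω ∈ S ∧ ω (n + 1) = b} =
      envProb f α x (b - 1) * (walkLaw f α x).real
          {ω | Preorder.frestrictLe (π := fun _ => ℤ) n ω ∈ S ∧ ω n = b - 1} +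
        (1 - envProb f α x (b + 1)) * (walkLaw f α x).real
          {ω | Preorder.frestrictLe (π := fun _ => ℤ) n ω ∈ S ∧ ω n = b + 1} := by
  have h1 := (envProb_pos f α x (b - 1)).le
  have h2 : 0 ≤ 1 - envProb f α x (b + 1) := by linarith [envProb_lt_one f α x (b + 1)]
  simp only [Measure.real]
  rw [walkLaw_and_succ_eq f α x hS, ENNReal.toReal_add (by finiteness) (by finiteness),
    ENNReal.toReal_mul, ENNReal.toReal_mul, ENNReal.toReal_ofReal h1, ENNReal.toReal_ofReal h2]

lemma posProb_zero (a : ℤ) : posProb f α x 0 a = if a = 0 then 1 else 0 := by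
  have hT : MeasurableSet ((fun h : Finset.Iic 0 → ℤ => h ⟨0, Finset.mem_Iic.2 le_rfl⟩) ⁻¹' {a}) :=
    (measurable_pi_apply _) (measurableSet_singleton a)
  have h1 : walkLaw f α x {ω | ω 0 = a} = (Kernel.partialTraj (X := fun _ => ℤ)
      (historyKernel f α x) 0 0 fun _ => 0)
        ((fun h : Finset.Iic 0 → ℤ => h ⟨0, Finset.mem_Iic.2 le_rfl⟩) ⁻¹' {a}) := by
    rw [← Kernel.traj_map_frestrictLe_apply, Measure.map_apply (by fun_prop) hT]
    rfl
  rw [posProb, Measure.real, h1, Kernel.partialTraj_self, Kernel.id_apply, Measure.dirac_apply' _ hT]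
  by_cases h : a = 0
  · simp [h]
  · simp [h, Ne.symm h]

lemma posProb_succ (n : ℕ) (a : ℤ) : posProb f α x (n + 1) a =
    envProb f α x (a - 1) * posProb f α x n (a - 1) +
      (1 - envProb f α x (a + 1)) * posProb f α x n (a + 1) := by
  simpa [posProb] using walkLaw_real_and_succ_eq f α x (n := n) MeasurableSet.univ a

/-- `P_x (ξ_1 ≠ 0, …, ξ_n ≠ 0, ξ_{n+1} = a)`. -/
noncomputable def tabooProb (n : ℕ) (a : ℤ) : ℝ :=
  (walkLaw f α x).real {ω | (∀ i : ℕ, 1 ≤ i → i ≤ n → ω i ≠ 0) ∧ ω (n + 1) = a}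

lemma tabooProb_zero (a : ℤ) : tabooProb f α x 0 a = posProb f α x 1 a := by
  rw [tabooProb, posProb]
  congr 1
  ext ω
  exact ⟨fun h => h.2, fun h => ⟨fun i h1 h2 => by omega, h⟩⟩

lemma tabooProb_succ (n : ℕ) (a : ℤ) : tabooProb f α x (n + 1) a =
    envProb f α x (a - 1) * (if a - 1 = 0 then 0 else tabooProb f α x n (a - 1)) +
      (1 - envProb f α x (a + 1)) * (if a + 1 = 0 then 0 else tabooProb f α x n (a + 1)) := by
  set S : Set (Finset.Iic (n + 1) → ℤ) := {h | ∀ i : Finset.Iic (n + 1), 1 ≤ i.1 → h i ≠ 0}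
  have hS : MeasurableSet S := by
    have : S = ⋂ i : Finset.Iic (n + 1), ⋂ _ : 1 ≤ i.1, (fun h => h i) ⁻¹' {0}ᶜ := by
      ext h; simp [S]
    rw [this]
    exact MeasurableSet.iInter fun i => MeasurableSet.iInter fun _ =>
      measurable_pi_apply i (measurableSet_singleton 0).compl
  have hmem : ∀ ω : ℕ → ℤ, Preorder.frestrictLe (π := fun _ => ℤ) (n + 1) ω ∈ S ↔
      ∀ i : ℕ, 1 ≤ i → i ≤ n + 1 → ω i ≠ 0 := fun ω =>
    ⟨fun h i h1 h2 => h ⟨i, Finset.mem_Iic.2 h2⟩ h1, fun h i h1 => h i.1 h1 (Finset.mem_Iic.1 i.2)⟩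
  have key := walkLaw_real_and_succ_eq f α x hS a
  simp only [hmem] at key
  -- The constraint at time n + 1 excludes c = 0 and is automatic for any other c.
  have hset : ∀ c : ℤ, (walkLaw f α x).real
      {ω | (∀ i : ℕ, 1 ≤ i → i ≤ n + 1 → ω i ≠ 0) ∧ ω (n + 1) = c} =
        if c = 0 then 0 else tabooProb f α x n c := fun c => by
    split_ifs with hc
    · have : {ω : ℕ → ℤ | (∀ i : ℕ, 1 ≤ i → i ≤ n + 1 → ω i ≠ 0) ∧ ω (n + 1) = c} = ∅ := by
        ext ω
        simp only [Set.mem_ofPred_eq, Set.mem_empty_iff_false, iff_false, not_and]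
        intro h h'
        exact h (n + 1) (by omega) le_rfl (h'.trans hc)
      simp [this]
    · rw [tabooProb]
      congr 1
      ext ω
      simp only [Set.mem_ofPred_eq]
      refine ⟨fun h => ⟨fun i h1 h2 => h.1 i h1 (by omega), h.2⟩, fun h => ⟨fun i h1 h2 => ?_, h.2⟩⟩
      rcases Nat.lt_or_ge n i with h3 | h3
      · have : i = n + 1 := by omega
        rw [this, h.2]; exact hc
      · exact h.1 i h1 h3
  rw [hset, hset] at key
  exact key

variable {f α x} {m : ℤ → ℝ} (hr : Reversible (envProb f α x) m)
include hr

lemma Reversible.balance_sub (a : ℤ) :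
    m (a - 1) * envProb f α x (a - 1) = m a * (1 - envProb f α x a) := by
  have := hr.balance (a - 1)
  rwa [sub_add_cancel] at this

/-- Detailed balance converts the forward equation of `posProb` into the backward equation of
`trans`. -/
lemma weight_zero_mul_posProb (n : ℕ) (a : ℤ) :
    m 0 * posProb f α x n a = m a * trans (envProb f α x) 0 n a := by
  induction n generalizing a with
  | zero => rw [posProb_zero, trans_zero]; split_ifs with h <;> simp [h]
  | succ n ih =>
    rw [posProb_succ, trans_succ, avg]
    linear_combination envProb f α x (a - 1) * ih (a - 1) +
      (1 - envProb f α x (a + 1)) * ih (a + 1) - trans (envProb f α x) 0 n (a + 1) * hr.balance a +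
      trans (envProb f α x) 0 n (a - 1) * hr.balance_sub a

/-- A reversed path starts at a and first meets 0 at a positive time n + 1. Taking one step before
`hit` also covers a = 0. -/
lemma weight_zero_mul_tabooProb (n : ℕ) (a : ℤ) :
    m 0 * tabooProb f α x n a = m a * avg (envProb f α x) (hit (envProb f α x) 0 n) a := by
  induction n generalizing a with
  | zero =>
    rw [tabooProb_zero, weight_zero_mul_posProb hr, trans_succ]
    simp only [avg, hit, trans_zero]
  | succ n ih =>
    have h : ∀ c, m 0 * (if c = 0 then 0 else tabooProb f α x n c) =
        m c * hit (envProb f α x) 0 (n + 1) c := fun c => by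
      simp only [hit]
      split_ifs with hc
      · simp
      · exact ih c
    rw [tabooProb_succ, avg]
    linear_combination envProb f α x (a - 1) * h (a - 1) +
      (1 - envProb f α x (a + 1)) * h (a + 1) -
      hit (envProb f α x) 0 (n + 1) (a + 1) * hr.balance a +
      hit (envProb f α x) 0 (n + 1) (a - 1) * hr.balance_sub a

/-- For a recurrent walk, the excursion density is the reversible measure. -/
lemma excursionDensity_eq (hs : ∀ k, Tendsto (fun n => surv (envProb f α x) 0 n k) atTop (𝓝 0))
    (a : ℤ) : excursionDensity f α x a = ENNReal.ofReal (m a / m 0) := by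
  have h0 := hr.weight_pos 0
  -- The last factor is the probability, from a, of visiting 0 at some time in [1, n + 1];
  -- recurrence sends it to 1.
  have hpart : ∀ n, ∑ i ∈ Finset.range (n + 1), tabooProb f α x i a =
      m a / m 0 * (1 - avg (envProb f α x) (surv (envProb f α x) 0 n) a) := fun n => by
    have h1 : ∀ i, tabooProb f α x i a =
        m a / m 0 * (envProb f α x a * hit (envProb f α x) 0 i (a + 1) +
          (1 - envProb f α x a) * hit (envProb f α x) 0 i (a - 1)) := fun i => by
      have := weight_zero_mul_tabooProb hr i a
      rw [avg] at this
      rw [div_mul_eq_mul_div, eq_div_iff h0.ne']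
      linarith
    simp only [h1]
    rw [← Finset.mul_sum, Finset.sum_add_distrib, ← Finset.mul_sum, ← Finset.mul_sum, sum_hit,
      sum_hit, avg]
    ring
  have hnn : ∀ i, 0 ≤ tabooProb f α x i a := fun i => measureReal_nonneg
  have hsum : HasSum (fun i => tabooProb f α x i a) (m a / m 0) := by
    rw [hasSum_iff_tendsto_nat_of_nonneg hnn, ← tendsto_add_atTop_iff_nat 1]
    simp only [hpart, avg]
    have := (((hs (a + 1)).const_mul (envProb f α x a)).add
      ((hs (a - 1)).const_mul (1 - envProb f α x a))).const_sub 1 |>.const_mul (m a / m 0)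
    simpa using this
  rw [← hsum.tsum_eq, ENNReal.ofReal_tsum_of_nonneg hnn hsum.summable, excursionDensity]
  refine tsum_congr fun i => ?_
  rw [tabooProb, ofReal_measureReal]

end Law

/-! ### The quasi-periodic environment and uniformity in x. -/

section Environment

variable (f : UnitAddCircle → ℝ) (α : ℝ) (x : UnitAddCircle)

/-- The Birkhoff sums of `f` over the rotation, for positive and negative times. -/
noncomputable def potential (k : ℤ) : ℝ :=
  ∑ i ∈ Finset.range k.toNat, f (site α x i) -
    ∑ i ∈ Finset.range (-k).toNat, f (site α x (-(i + 1)))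

lemma potential_add_one (k : ℤ) : potential f α x (k + 1) = potential f α x k + f (site α x k) := by
  obtain ⟨n, rfl | rfl⟩ : ∃ n : ℕ, k = n ∨ k = -(n + 1) := by
    rcases le_or_gt 0 k with h | h
    · exact ⟨k.toNat, Or.inl (by omega)⟩
    · exact ⟨(-k - 1).toNat, Or.inr (by omega)⟩
  · have h1 : ((n : ℤ) + 1).toNat = n + 1 := by omega
    have h2 : (-((n : ℤ) + 1)).toNat = 0 := by omega
    have h3 : (-(n : ℤ)).toNat = 0 := by omega
    simp only [potential, h1, h2, h3, Finset.sum_range_succ, Int.toNat_natCast]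
    simp
  · have h1 : (-((n : ℤ) + 1) + 1).toNat = 0 := by omega
    have h2 : (-(-((n : ℤ) + 1) + 1)).toNat = n := by omega
    have h3 : (-((n : ℤ) + 1)).toNat = 0 := by omega
    have h4 : (- -((n : ℤ) + 1)).toNat = n + 1 := by omega
    simp only [potential, h1, h2, h3, h4, Finset.sum_range_succ]
    ring

lemma site_site (j k : ℤ) : site α (site α x j) k = site α x (j + k) := by
  simp only [site, add_assoc, ← AddCircle.coe_add]
  congr 2; push_cast; ring

/-- Denjoy–Koksma is uniform in the base point, so moving it to x - qα lets the bound serve negative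
times as well. -/
lemma potential_neg (q : ℕ) :
    potential f α x (-q) = -∑ k ∈ Finset.range q, f (site α (site α x (-q)) k) := by
  have h1 : (-(q : ℤ)).toNat = 0 := by omega
  have h2 : (- -(q : ℤ)).toNat = q := by omega
  rw [potential, h1, h2, Finset.range_zero, Finset.sum_empty, zero_sub,
    ← Finset.sum_range_reflect (fun i : ℕ => f (site α x (-(i + 1))))]
  simp only [site_site]
  congr 1
  refine Finset.sum_congr rfl fun i hi => ?_
  rw [Finset.mem_range] at hi
  congr 2
  omega

lemma potential_natCast (q : ℕ) :
    potential f α x q = ∑ k ∈ Finset.range q, f (site α x k) := by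
  simp [potential]

/-- The odds p/(1 - p) are exp f, and f is the increment of the potential. -/
lemma envProb_eq (k : ℤ) : envProb f α x k =
    Real.exp (potential f α x (k + 1) - potential f α x k) * (1 - envProb f α x k) := by
  rw [potential_add_one, add_sub_cancel_left, envProb, rightProb]
  have : 0 < Real.exp (f (site α x k)) := Real.exp_pos _
  field_simp
  ring

/-- The reversible measure of the walk. -/
noncomputable def weight (k : ℤ) : ℝ := Real.exp (potential f α x k) / (1 - envProb f α x k)

lemma reversible_weight : Reversible (envProb f α x) (weight f α x) where
  pos := envProb_pos f α x
  lt_one := envProb_lt_one f α x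
  weight_pos k := div_pos (Real.exp_pos _) (by linarith [envProb_lt_one f α x k])
  balance k := by
    have h1 : 0 < 1 - envProb f α x k := by linarith [envProb_lt_one f α x k]
    have h2 : 0 < 1 - envProb f α x (k + 1) := by linarith [envProb_lt_one f α x (k + 1)]
    have h3 := envProb_eq f α x k
    rw [Real.exp_sub, div_mul_eq_mul_div, eq_div_iff (Real.exp_pos _).ne'] at h3
    rw [weight, weight, div_mul_cancel₀ _ h2.ne', div_mul_eq_mul_div, div_eq_iff h1.ne']
    linarith

variable {f}

lemma continuous_comp_site (hf : Continuous f) (k : ℤ) : Continuous fun x => f (site α x k) :=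
  hf.comp (continuous_id.add continuous_const)

lemma continuous_envProb (hf : Continuous f) (k : ℤ) : Continuous fun x => envProb f α x k := by
  have h := (continuous_comp_site α hf k).rexp
  exact h.div (continuous_const.add h) fun x => by positivity

lemma continuous_weight (hf : Continuous f) (k : ℤ) : Continuous fun x => weight f α x k := by
  refine Continuous.div ?_ (continuous_const.sub (continuous_envProb α hf k)) fun x => ?_
  · refine Real.continuous_exp.comp (Continuous.sub ?_ ?_) <;>
      exact continuous_finsetSum _ fun i _ => continuous_comp_site α hf _
  · exact (sub_pos.2 (envProb_lt_one f α x k)).ne'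

lemma continuous_surv (hf : Continuous f) (b : ℤ) (n : ℕ) (k : ℤ) :
    Continuous fun x => surv (envProb f α x) b n k := by
  induction n generalizing k with
  | zero => exact continuous_const
  | succ n ih =>
    by_cases h : k = b
    · simp only [h, surv_self]; exact continuous_const
    · simp only [surv_succ_of_ne _ h, avg]
      exact ((continuous_envProb α hf k).mul (ih _)).add
        ((continuous_const.sub (continuous_envProb α hf k)).mul (ih _))

variable {α}

/-- The walk is recurrent in every environment. -/
lemma tendsto_surv_envProb (hα : Irrational α) (hf : Continuous f) (hBV : CircleBV f)
    (hmean : ∫ z, f z = 0) (b k : ℤ) :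
    Tendsto (fun n => surv (envProb f α x) b n k) atTop (𝓝 0) := by
  obtain ⟨C, hC⟩ := exists_abs_birkhoff_le hα hf hBV hmean
  refine tendsto_surv_zero (envProb_pos f α x) (envProb_lt_one f α x) (envProb_eq f α x) (C := C)
    (frequently_atTop.2 fun N => ?_) (frequently_atTop.2 fun N => ?_) b k
  · obtain ⟨q, hq, h⟩ := hC N
    refine ⟨q, hq, ?_⟩
    rw [potential_natCast]
    exact (abs_le.1 (h x)).2
  · obtain ⟨q, hq, h⟩ := hC N
    refine ⟨q, hq, ?_⟩
    rw [potential_neg]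
    linarith [(abs_le.1 (h (site α x (-q)))).1]

/-- Dini's theorem on the compact circle. -/
lemma tendstoUniformly_surv_envProb (hα : Irrational α) (hf : Continuous f) (hBV : CircleBV f)
    (hmean : ∫ z, f z = 0) (b k : ℤ) :
    TendstoUniformly (fun n x => surv (envProb f α x) b n k) (fun _ => 0) atTop :=
  Antitone.tendstoUniformly_of_forall_tendsto (fun n => continuous_surv α hf b n k)
    (fun _ _ h x => surv_antitone (envProb_pos f α x) (envProb_lt_one f α x) b k h)
    continuous_const fun x => tendsto_surv_envProb x hα hf hBV hmean b k

lemma exists_surv_envProb_le (hα : Irrational α) (hf : Continuous f) (hBV : CircleBV f)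
    (hmean : ∫ z, f z = 0) {ε : ℝ} (hε : 0 < ε) (L : ℤ) : ∃ N : ℕ, ∀ x : UnitAddCircle, ∀ a : ℤ,
      |a| ≤ L → surv (envProb f α x) 0 N a ≤ ε ∧ surv (envProb f α x) a N 0 ≤ ε := by
  have h : ∀ b k : ℤ, ∀ᶠ n in atTop, ∀ x, surv (envProb f α x) b n k ≤ ε := fun b k => by
    filter_upwards [Metric.tendstoUniformly_iff.1
      (tendstoUniformly_surv_envProb hα hf hBV hmean b k) ε hε] with n hn x
    have := hn x
    rw [dist_zero_left, Real.norm_eq_abs] at this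
    exact (le_abs_self _).trans this.le
  obtain ⟨N, hN⟩ := ((Filter.eventually_all_finite (Set.finite_Icc (-L) L)).2
    fun a _ => (h 0 a).and (h a 0)).exists
  exact ⟨N, fun x a ha => ⟨(hN a (abs_le.1 ha)).1 x, (hN a (abs_le.1 ha)).2 x⟩⟩

/-- By compactness; M turns a relative error into an absolute one, uniformly in x. -/
lemma exists_weight_div_weight_le (hf : Continuous f) (L : ℤ) : ∃ M : ℝ, 0 < M ∧
    ∀ (x : UnitAddCircle) (a b : ℤ), |a| ≤ L → |b| ≤ L → weight f α x a / weight f α x b ≤ M := by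
  have hpos : ∀ x k, 0 < weight f α x k := fun x k => (reversible_weight f α x).weight_pos k
  have hc : Continuous fun x => ∑ a ∈ Finset.Icc (-L) L, ∑ b ∈ Finset.Icc (-L) L,
      weight f α x a / weight f α x b :=
    continuous_finsetSum _ fun a _ => continuous_finsetSum _ fun b _ =>
      (continuous_weight α hf a).div (continuous_weight α hf b) fun x => (hpos x b).ne'
  obtain ⟨M, hM⟩ := (isCompact_range hc).bddAbove
  refine ⟨max M 1, by positivity, fun x a b ha hb => le_max_of_le_left ?_⟩
  refine le_trans ?_ (hM ⟨x, rfl⟩)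
  have hnn : ∀ a b, 0 ≤ weight f α x a / weight f α x b := fun a b =>
    (div_pos (hpos x a) (hpos x b)).le
  refine (Finset.single_le_sum (f := fun b => weight f α x a / weight f α x b)
    (fun b _ => hnn a b) (Finset.mem_Icc.2 (abs_le.1 hb))).trans ?_
  exact Finset.single_le_sum
    (f := fun a => ∑ b ∈ Finset.Icc (-L) L, weight f α x a / weight f α x b)
    (fun a _ => Finset.sum_nonneg fun b _ => hnn a b) (Finset.mem_Icc.2 (abs_le.1 ha))

end Environment

end QuasiPeriodicWalk

/-! ### The ratio limit theorem. -/

open QuasiPeriodicWalk in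
theorem theoremA (α : ℝ) (hα : Irrational α) (f : UnitAddCircle → ℝ) (hf : Continuous f)
    (hBV : CircleBV f) (hmean : ∫ z, f z = 0) :
    (∀ (x : UnitAddCircle) (a : ℤ),
      0 < excursionDensity f α x a ∧ excursionDensity f α x a < ∞) ∧
    ∀ ε : ℝ, 0 < ε → ∀ q : ℕ, 2 ≤ q → ∃ n₀ : ℕ, ∀ n : ℕ, n₀ ≤ n → ∀ x : UnitAddCircle,
      ∀ a b : ℤ, |a| ≤ q → |b| ≤ q → a ≡ n [ZMOD 2] → b ≡ n [ZMOD 2] →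
        0 < posProb f α x n b ∧
        |posProb f α x n a / posProb f α x n b -
          (excursionDensity f α x a).toReal / (excursionDensity f α x b).toReal| < ε := by
  have hex : ∀ x a, excursionDensity f α x a =
      ENNReal.ofReal (weight f α x a / weight f α x 0) := fun x a =>
    excursionDensity_eq (reversible_weight f α x)
      (fun k => tendsto_surv_envProb x hα hf hBV hmean 0 k) a
  have hpos : ∀ x k, 0 < weight f α x k := fun x k => (reversible_weight f α x).weight_pos k
  refine ⟨fun x a => ?_, fun ε hε q _ => ?_⟩
  · rw [hex]
    exact ⟨ENNReal.ofReal_pos.2 (div_pos (hpos x a) (hpos x 0)), ENNReal.ofReal_lt_top⟩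
  · obtain ⟨M, hM0, hM⟩ := exists_weight_div_weight_le (α := α) hf q
    -- 1/4 is required by the comparison of starting points; the other term makes M · 4δ at most
    -- ε/2.
    set δ := min (1 / 4) (ε / (8 * M))
    have hδ : 0 < δ := by positivity
    have hδM : M * (4 * δ) < ε := by
      have : δ * (8 * M) ≤ ε := (le_div_iff₀ (by positivity)).1 (min_le_right _ _)
      linarith
    obtain ⟨N, hN⟩ := exists_surv_envProb_le hα hf hBV hmean hδ (q + 1)
    refine ⟨N + 1, fun n hn x a b ha hb han hbn => ?_⟩
    have hr := reversible_weight f α x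
    obtain ⟨h1, h2⟩ := abs_trans_div_trans_sub_one_le hr (min_le_left _ _) hn
      (fun a ha => (hN x a ha).1) (fun a ha => (hN x a ha).2) ha hb han hbn
    have hw : ∀ c, posProb f α x n c =
        weight f α x c / weight f α x 0 * trans (envProb f α x) 0 n c := fun c => by
      have := weight_zero_mul_posProb hr n c
      rw [div_mul_eq_mul_div, eq_div_iff (hpos x 0).ne']
      linarith
    have h0 := hpos x 0
    have ha' := hpos x a
    have hb' := hpos x b
    rw [hw, hw, hex, hex, ENNReal.toReal_ofReal (by positivity), ENNReal.toReal_ofReal (by positivity)]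
    refine ⟨by positivity, ?_⟩
    -- Both ratios contain m_a/m_b, which factors out.
    have e : weight f α x a / weight f α x 0 * trans (envProb f α x) 0 n a /
          (weight f α x b / weight f α x 0 * trans (envProb f α x) 0 n b) -
        weight f α x a / weight f α x 0 / (weight f α x b / weight f α x 0) =
        weight f α x a / weight f α x b *
          (trans (envProb f α x) 0 n a / trans (envProb f α x) 0 n b - 1) := by
      field_simp
    rw [e, abs_mul, abs_of_pos (div_pos ha' hb')]
    refine lt_of_le_of_lt ?_ hδM
    have := hM x a b ha hb
    gcongr
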